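/- Let $k$ be an infinite field, let $S=k[x_0,\dots,x_n]$, and let $W$ be an $(r+1)$-dimensional $k$-vector space of forms of the same degree in $S$, with basis $f_0,\dots,f_r$. Assume that the ideal $I=(f_0,\dots,f_r)$ generated by $W$ has codimension at least $2$ (the unit ideal having codimension $\infty$), and let $\phi=[f_0:\dots:f_r]:\mathbf P^n\dashrightarrow\mathbf P^r=\mathbf P(W)$ be the associated rational map. Let $A=(A_{ij})$ be a matrix of homogeneous forms of $S$ with $r+1$ rows, each of whose columns is a syzygy on $f_0,\dots,f_r$, i.e. $\sum_i f_iA_{ij}=0$ for all $j$. For a $k$-rational point $q=[q_0:\dots:q_r]$ of $\mathbf P^r$ let $A_q\subset S$ be the ideal generated by the entries $\sum_i q_iA_{ij}$ of the generalized row of $A$ corresponding to $q$. Suppose that, for some such $q$, there is a prime ideal $P$ of $S$ containing $A_q$ such that the matrix $A\otimes\kappa(P)$ over the residue field $\kappa(P)$ of $P$ has rank $r$. Then: 1. If the subscheme of $\mathbf P^n$ defined by $A_q$ is a reduced $k$-rational point, then $\phi$ is birational onto its image. 2. If the subscheme of $\mathbf P^n$ defined by $A_q$ is a (nonempty) linear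 subspace of codimension $r$ with its reduced structure, then the restriction of $\phi$ to a general linear subspace $\mathbf P^r\subset\mathbf P^n$ is a birational map $\mathbf P^r\dashrightarrow\mathbf P^r$, that is, a Cremona transformation. -/

import Mathlib

open MvPolynomial
open scoped LinearAlgebra.Projectivization

noncomputable section

namespace RowIdeals

variable {k : Type*} [Field k]

/-- The ideal of `k[x_0,…,x_n]` generated by the linear forms vanishing on the subspace `V` of
`k^{n+1}`, i.e. the homogeneous ideal of the (reduced) linear subvariety `ℙ(V) ⊆ ℙⁿ` consisting of
the lines in `V`. -/
def linearIdeal {n : ℕ} (V : Submodule k (Fin (n + 1) → k)) :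
    Ideal (MvPolynomial (Fin (n + 1)) k) :=
  Ideal.span {l | ∃ a : Fin (n + 1) → k, (∀ v ∈ V, ∑ i, a i * v i = 0) ∧ l = ∑ i, C (a i) * X i}

/-- The saturation `⋃_N (J : 𝔪^N)` of `J` with respect to `𝔪 = (x_0,…,x_n)`. Two homogeneous ideals
define the same closed subscheme of `ℙⁿ` iff their saturations agree. -/
def saturation {n : ℕ} (J : Ideal (MvPolynomial (Fin (n + 1)) k)) :
    Ideal (MvPolynomial (Fin (n + 1)) k) :=
  ⨆ N : ℕ, J.colon ((idealOfVars (Fin (n + 1)) k ^ N : Ideal _) : Set _)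

theorem mem_saturation {n : ℕ} {J : Ideal (MvPolynomial (Fin (n + 1)) k)}
    {a : MvPolynomial (Fin (n + 1)) k} :
    a ∈ saturation J ↔ ∃ N : ℕ, ∀ b ∈ idealOfVars (Fin (n + 1)) k ^ N, a * b ∈ J := by
  unfold saturation
  rw [Submodule.mem_iSup_of_directed]
  · simp [Submodule.mem_colon]
  · refine Monotone.directed_le fun N M h => ?_
    exact Submodule.colon_mono le_rfl (Ideal.pow_le_pow_right h)

/-- The subscheme of `ℙⁿ` defined by `J` is a reduced `k`-rational point. -/
def DefinesReducedRationalPoint {n : ℕ} (J : Ideal (MvPolynomial (Fin (n + 1)) k)) : Prop :=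
  ∃ p : ℙ k (Fin (n + 1) → k), saturation J = linearIdeal p.submodule

/-- The subscheme of `ℙⁿ` defined by `J` is a (nonempty) linear subspace of codimension `c`, with
its reduced structure. -/
def DefinesReducedLinearSpace {n : ℕ} (J : Ideal (MvPolynomial (Fin (n + 1)) k)) (c : ℕ) : Prop :=
  ∃ V : Submodule k (Fin (n + 1) → k), V ≠ ⊥ ∧ Module.finrank k V + c = n + 1 ∧
    saturation J = linearIdeal V

/-- The ideal `A_q`, generated by the entries of the generalized row of `A` corresponding to the
`k`-rational point `q = [q_0 : … : q_r]` of `ℙ^r = ℙ(W)`, where `W` has basis `f_0,…,f_r`. The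
hyperplane `W_q` of `W` is `{∑ a_i f_i | ∑ a_i q_i = 0}`, so `W → W / W_q ≅ k` sends `f_i` to `q_i`
and the entries of the generalized row are the `∑ i, q_i A_{ij}`. -/
def generalizedRowIdeal {n r m : ℕ} (A : Matrix (Fin (r + 1)) (Fin m) (MvPolynomial (Fin (n + 1)) k))
    (q : ℙ k (Fin (r + 1) → k)) : Ideal (MvPolynomial (Fin (n + 1)) k) :=
  Ideal.span (Set.range fun j : Fin m => ∑ i, C (q.rep i) * A i j)

/-- The rational map `ℙⁿ ⇢ ℙ^r`, `x ↦ [f_0(x) : … : f_r(x)]`, given by forms `f_i` of the same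
degree, is birational onto (the closure of) its image `Y`: there is a rational map `Y ⇢ ℙⁿ`, given
by forms `g_0,…,g_n` of the same degree in the homogeneous coordinates `y_0,…,y_r` of `ℙ^r`, such
that both composites are defined (not all their coordinates vanish identically) and equal the
identity of `ℙⁿ` and of `Y`, as rational maps. A form `h` vanishes on `Y` iff
`h(f_0,…,f_r) = aeval f h = 0`; two tuples of coordinates define the same rational map iff their
`2 × 2` minors vanish. -/
def IsBirationalOntoImage {n r : ℕ} (f : Fin (r + 1) → MvPolynomial (Fin (n + 1)) k) : Prop :=
  ∃ (e : ℕ) (g : Fin (n + 1) → MvPolynomial (Fin (r + 1)) k),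
    (∀ i, (g i).IsHomogeneous e) ∧
    (∃ i, aeval f (g i) ≠ 0) ∧
    (∀ i j, aeval f (g i) * X j = aeval f (g j) * X i) ∧
    (∃ i, aeval f (aeval g (f i)) ≠ 0) ∧
    (∀ i j, aeval f (aeval g (f i) * X j - aeval g (f j) * X i) = 0)

/-- The rational map `ℙ^r ⇢ ℙ^r` given by forms `f_0,…,f_r` of the same degree is a Cremona
transformation, i.e. it has an inverse rational map `ℙ^r ⇢ ℙ^r`. -/
def IsCremona {r : ℕ} (f : Fin (r + 1) → MvPolynomial (Fin (r + 1)) k) : Prop :=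
  ∃ (e : ℕ) (g : Fin (r + 1) → MvPolynomial (Fin (r + 1)) k),
    (∀ i, (g i).IsHomogeneous e) ∧
    (∃ i, aeval f (g i) ≠ 0) ∧
    (∀ i j, aeval f (g i) * X j = aeval f (g j) * X i) ∧
    (∃ i, aeval g (f i) ≠ 0) ∧
    (∀ i j, aeval g (f i) * X j = aeval g (f j) * X i)

/-- The restriction of `[f_0 : … : f_r]` to the image of the linear map `ℙ^s → ℙⁿ`, `y ↦ M y`
(a linear embedding when `M` has rank `s + 1`). -/
def restrictTo {n r s : ℕ} (f : Fin (r + 1) → MvPolynomial (Fin (n + 1)) k)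
    (M : Matrix (Fin (n + 1)) (Fin (s + 1)) k) : Fin (r + 1) → MvPolynomial (Fin (s + 1)) k :=
  fun i => aeval (fun a => ∑ b, C (M a b) * X b) (f i)

/-- The property `Q` holds for a general (linearly parametrized) `ℙ^s ⊆ ℙⁿ`: there is a nonzero
polynomial `G` in the entries of an `(n+1) × (s+1)` matrix such that `Q` holds for every linear
embedding `ℙ^s ↪ ℙⁿ` outside the hypersurface `G = 0`. -/
def ForGeneralLinearSubspace (n s : ℕ) (Q : Matrix (Fin (n + 1)) (Fin (s + 1)) k → Prop) : Prop :=
  ∃ G : MvPolynomial (Fin (n + 1) × Fin (s + 1)) k, G ≠ 0 ∧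
    ∀ M : Matrix (Fin (n + 1)) (Fin (s + 1)) k, M.rank = s + 1 →
      eval (fun ab => M ab.1 ab.2) G ≠ 0 → Q M

end RowIdeals

end

/-!
Since some `r × r` minor of `A` is nonzero at `P` and `f` is killed by `A`, the vector `f` is
proportional to `q` modulo the linear ideal of `A_q`. It is nonzero there by Krull's height theorem:
the minor would otherwise force all `f i` to vanish on a component of the hypersurface `f i₀ = 0`,
against `2 ≤ codim I`. So `φ` sends the generic point of the linear space to `q`.

When that space is a point where `x_a ≠ 0`, all monomials of some large degree `D` lie, modulo
`x_a ^ D`, in the generalized row at `q` of the matrix of all syzygies. Spelled out, this is a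
linear system `∑_ν L_{μν}(f) x^ν = x_a ^ D b_μ(f)` whose coefficients are linear forms in `f`, with
`L(q) = 1`. As `φ` maps the point to `q`, `det L(f) ≠ 0`, and Cramer's rule expresses the ratios
`x_i / x_a` rationally in `f`: this is a left inverse of `φ`.

A general `ℙ^r` meets a linear space of codimension `r` in one point, at which `f` does not vanish,
and the same argument applies to the restriction of `φ`. A left inverse of a rational map
`ℙ^r ⇢ ℙ^r` is an inverse, because it makes the forms `f i` algebraically independent.
-/

noncomputable section

namespace RowIdeals

section LinearAlgebra

open Matrix

theorem map_cramer {S T ι : Type*} [CommRing S] [CommRing T] [Fintype ι] [DecidableEq ι]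
    (φ : S →+* T) (L : Matrix ι ι S) (b : ι → S) : φ ∘ L.cramer b = (L.map φ).cramer (φ ∘ b) := by
  rw [← RingHom.mapMatrix_apply, cramer_eq_adjugate_mulVec, cramer_eq_adjugate_mulVec,
    ← RingHom.map_adjugate, RingHom.mapMatrix_apply]
  exact funext (RingHom.map_mulVec φ _ _)

theorem rank_submatrix_succAbove_eq_rank {F κ : Type*} [Field F] [Fintype κ] {r : ℕ}
    (A : Matrix (Fin (r + 1)) κ F) {q : Fin (r + 1) → F} (hqA : q ᵥ* A = 0) {i₀ : Fin (r + 1)}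
    (hq : q i₀ ≠ 0) : (A.submatrix i₀.succAbove id).rank = A.rank := by
  have hker : LinearMap.ker (A.submatrix i₀.succAbove id).mulVecLin =
      LinearMap.ker A.mulVecLin := by
    ext c
    simp only [LinearMap.mem_ker, mulVecLin_apply]
    refine ⟨fun hc => ?_, fun hc => funext fun t => congrFun hc (i₀.succAbove t)⟩
    have hsucc : ∀ t, (A *ᵥ c) (i₀.succAbove t) = 0 := congrFun hc
    have hdot : q ⬝ᵥ A *ᵥ c = 0 := by rw [dotProduct_mulVec, hqA, zero_dotProduct]
    have hi₀ : (A *ᵥ c) i₀ = 0 := by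
      simpa [dotProduct, Fin.sum_univ_succAbove _ i₀, hsucc, hq] using hdot
    ext i
    rcases Fin.eq_self_or_eq_succAbove i₀ i with rfl | ⟨t, rfl⟩
    exacts [hi₀, hsucc t]
  have h₁ := (A.submatrix i₀.succAbove id).mulVecLin.finrank_range_add_finrank_ker
  have h₂ := A.mulVecLin.finrank_range_add_finrank_ker
  rw [hker] at h₁
  exact Nat.add_right_cancel (h₁.trans h₂.symm)

theorem exists_det_submatrix_ne_zero {F κ : Type*} [Field F] [Fintype κ] {r : ℕ}
    (B : Matrix (Fin r) κ F) (hB : B.rank = r) : ∃ s : Fin r → κ, (B.submatrix id s).det ≠ 0 := by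
  have hspan : Module.finrank F (Submodule.span F (Set.range B.col)) = r := by
    rw [← rank_eq_finrank_span_cols, hB]
  obtain ⟨b, hb, -, hli⟩ := Submodule.exists_fun_fin_finrank_span_eq F (Set.range B.col)
  choose s hs using hb
  refine ⟨s ∘ finCongr hspan.symm, ?_⟩
  have hcol : (B.submatrix id (s ∘ finCongr hspan.symm)).col = b ∘ finCongr hspan.symm :=
    funext fun i => hs _
  rw [← isUnit_iff_ne_zero, ← isUnit_iff_isUnit_det, ← linearIndependent_cols_iff_isUnit, hcol]
  exact hli.comp _ (finCongr hspan.symm).injective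

theorem det_mul_mem_of_vecMul_mem {S κ : Type*} [CommRing S] {r : ℕ}
    (A : Matrix (Fin (r + 1)) κ S) (Q : Ideal S) {v : Fin (r + 1) → S}
    (hvA : ∀ j, (v ᵥ* A) j ∈ Q) {i₀ : Fin (r + 1)} (hv : v i₀ ∈ Q) (s : Fin r → κ)
    (i : Fin (r + 1)) : (A.submatrix i₀.succAbove s).det * v i ∈ Q := by
  rcases Fin.eq_self_or_eq_succAbove i₀ i with rfl | ⟨t, rfl⟩
  · exact Q.mul_mem_left _ hv
  set B := A.submatrix i₀.succAbove s
  have hvB : ∀ u, ((v ∘ i₀.succAbove) ᵥ* B) u ∈ Q := fun u => by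
    have h : (v ᵥ* A) (s u) = v i₀ * A i₀ (s u) + ((v ∘ i₀.succAbove) ᵥ* B) u :=
      Fin.sum_univ_succAbove _ i₀
    exact (Q.add_mem_iff_right (Q.mul_mem_right _ hv)).1 (h ▸ hvA (s u))
  have hadj : ((v ∘ i₀.succAbove) ᵥ* B) ᵥ* B.adjugate = B.det • (v ∘ i₀.succAbove) := by
    rw [vecMul_vecMul, mul_adjugate, vecMul_smul, vecMul_one]
  have hdet : ∑ u, ((v ∘ i₀.succAbove) ᵥ* B) u * B.adjugate u t = B.det * v (i₀.succAbove t) :=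
    congrFun hadj t
  exact hdet ▸ Q.sum_mem fun u _ => Q.mul_mem_right _ (hvB u)

theorem exists_det_submatrix_notMem {S κ : Type*} [CommRing S] [Fintype κ] {r : ℕ}
    (A : Matrix (Fin (r + 1)) κ S) (P : Ideal S) [P.IsPrime]
    (hrank : (A.map (algebraMap S P.ResidueField)).rank = r) {q : Fin (r + 1) → S}
    (hqA : ∀ j, (q ᵥ* A) j ∈ P) {i₀ : Fin (r + 1)} (hq : q i₀ ∉ P) :
    ∃ s : Fin r → κ, (A.submatrix i₀.succAbove s).det ∉ P := by
  have hmem : ∀ x, algebraMap S P.ResidueField x = 0 ↔ x ∈ P := fun _ =>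
    Ideal.algebraMap_residueField_eq_zero
  have hqA' : (algebraMap S P.ResidueField ∘ q) ᵥ* A.map (algebraMap S P.ResidueField) = 0 := by
    ext j
    rw [← RingHom.map_vecMul]
    exact (hmem _).2 (hqA j)
  obtain ⟨s, hs⟩ := exists_det_submatrix_ne_zero _
    ((rank_submatrix_succAbove_eq_rank _ hqA' ((hmem _).not.2 hq)).trans hrank)
  refine ⟨s, fun h => hs ?_⟩
  rw [← hmem, RingHom.map_det] at h
  exact h

end LinearAlgebra

section GenericImage

open Matrix

/-- For a prime `J`, the rational map with coordinates `f` is defined at the generic point of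
`V(J)` and takes there the value `[q]`; equality of points is expressed by `2 × 2` minors. -/
structure MapsGenericPointTo {ι S : Type*} [CommRing S] (f : ι → S) (J : Ideal S)
    (q : ι → S) : Prop where
  exists_notMem : ∃ i, f i ∉ J
  mul_sub_mul_mem : ∀ i j, f i * q j - f j * q i ∈ J

theorem MapsGenericPointTo.ne_zero {ι S : Type*} [CommRing S] {f : ι → S} {J : Ideal S}
    {q : ι → S} (h : MapsGenericPointTo f J q) : f ≠ 0 := by
  rintro rfl
  obtain ⟨_, hi⟩ := h.exists_notMem
  exact hi J.zero_mem

theorem notMem_of_two_le_height {S κ : Type*} [CommRing S] [IsNoetherianRing S] {r : ℕ}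
    {A : Matrix (Fin (r + 1)) κ S} {f : Fin (r + 1) → S} (hfA : f ᵥ* A = 0)
    (hf : 2 ≤ (Ideal.span (Set.range f)).height) {J : Ideal S} [J.IsPrime] {i₀ : Fin (r + 1)}
    {s : Fin r → κ} (hdet : (A.submatrix i₀.succAbove s).det ∉ J) : f i₀ ∉ J := by
  intro hi₀
  obtain ⟨Q, hQ, hQJ⟩ := Ideal.exists_minimalPrimes_le
    ((Ideal.span_singleton_le_iff_mem J).2 hi₀)
  have := hQ.1.1
  have hfQ : Ideal.span (Set.range f) ≤ Q := by
    rw [Ideal.span_le]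
    rintro _ ⟨i, rfl⟩
    have hmem := det_mul_mem_of_vecMul_mem A Q (v := f) (by simp [hfA])
      (hQ.1.2 (Ideal.mem_span_singleton_self (f i₀))) s i
    exact (‹Q.IsPrime›.mem_or_mem hmem).resolve_left fun h => hdet (hQJ h)
  have hQ₁ : Q.height ≤ 1 := Ideal.height_le_one_of_isPrincipal_of_mem_minimalPrimes _ Q hQ
  exact absurd ((hf.trans (Ideal.height_mono hfQ)).trans hQ₁) (by decide)

theorem mapsGenericPointTo_of_det_notMem {S κ : Type*} [CommRing S] [IsNoetherianRing S] {r : ℕ}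
    {A : Matrix (Fin (r + 1)) κ S} {f : Fin (r + 1) → S} (hfA : f ᵥ* A = 0)
    (hf : 2 ≤ (Ideal.span (Set.range f)).height) {J : Ideal S} [J.IsPrime]
    {q : Fin (r + 1) → S} (hqA : ∀ j, (q ᵥ* A) j ∈ J) {i₀ : Fin (r + 1)} (hq : q i₀ ∉ J)
    {s : Fin r → κ} (hdet : (A.submatrix i₀.succAbove s).det ∉ J) : MapsGenericPointTo f J q := by
  have hi₀ : ∀ i, f i₀ * q i - q i₀ * f i ∈ J := fun i => by
    have hmem := det_mul_mem_of_vecMul_mem A J (v := f i₀ • q - q i₀ • f) (i₀ := i₀)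
      (fun j => by
        rw [sub_vecMul, smul_vecMul, smul_vecMul, hfA, smul_zero, sub_zero]
        exact J.mul_mem_left _ (hqA j))
      (by simp [mul_comm]) s i
    exact (‹J.IsPrime›.mem_or_mem hmem).resolve_left hdet
  refine ⟨⟨i₀, notMem_of_two_le_height hfA hf hdet⟩, fun i j => ?_⟩
  have hmul : q i₀ * (f i * q j - f j * q i) ∈ J := by
    have := J.sub_mem (J.mul_mem_left (q i) (hi₀ j)) (J.mul_mem_left (q j) (hi₀ i))
    convert this using 1
    ring
  exact (‹J.IsPrime›.mem_or_mem hmul).resolve_left hq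

theorem aeval_mul_of_isHomogeneous {R T σ : Type*} [CommSemiring R] [CommSemiring T] [Algebra R T]
    {p : MvPolynomial σ R} {d : ℕ} (hp : p.IsHomogeneous d) (c : T) (x : σ → T) :
    aeval (fun i => c * x i) p = c ^ d * aeval x p := by
  rw [aeval_def, aeval_def, eval₂_eq, eval₂_eq, Finset.mul_sum]
  refine Finset.sum_congr rfl fun m hm => ?_
  have hm : ∑ i ∈ m.support, m i = d := by
    by_contra h
    exact mem_support_iff.1 hm (hp.coeff_eq_zero h)
  simp only [mul_pow, Finset.prod_mul_distrib, Finset.prod_pow_eq_pow_sum, hm]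
  ring

theorem MapsGenericPointTo.eval_eq_zero {ι k S : Type*} [Field k] [CommRing S] [Algebra k S]
    {f : ι → S} {J : Ideal S} [J.IsPrime] {q : ι → k}
    (hq : MapsGenericPointTo f J (algebraMap k S ∘ q)) {h : MvPolynomial ι k} {e : ℕ}
    (hh : h.IsHomogeneous e) (hfh : aeval f h ∈ J) : eval q h = 0 := by
  obtain ⟨i₀, hi₀⟩ := hq.exists_notMem
  let x : ι → S ⧸ J := fun i => Ideal.Quotient.mk J (f i)
  have hx : aeval x h = 0 := by
    have := Ideal.Quotient.eq_zero_iff_mem.2 hfh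
    rwa [← Ideal.Quotient.mkₐ_eq_mk k, comp_aeval_apply] at this
  have hminor : ∀ i, x i₀ * algebraMap k (S ⧸ J) (q i) = algebraMap k (S ⧸ J) (q i₀) * x i :=
    fun i => by
      rw [mul_comm (algebraMap k (S ⧸ J) (q i₀))]
      exact Ideal.Quotient.eq.2 (hq.mul_sub_mul_mem i₀ i)
  have hscale : x i₀ ^ e * aeval (algebraMap k (S ⧸ J) ∘ q) h = 0 := by
    rw [← aeval_mul_of_isHomogeneous hh]
    simp only [Function.comp_apply, hminor]
    rw [aeval_mul_of_isHomogeneous hh, hx, mul_zero]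
  have hqh := (mul_eq_zero.1 hscale).resolve_left
    (pow_ne_zero e fun h => hi₀ (Ideal.Quotient.eq_zero_iff_mem.1 h))
  rwa [aeval_algebraMap_apply, map_eq_zero_iff _ (algebraMap k (S ⧸ J)).injective] at hqh

end GenericImage

section LinearForms

open Matrix

variable {R σ ι : Type*} [CommSemiring R] [Fintype σ] [Fintype ι]

/-- The linear form with coefficient vector `a`. -/
def linearForm : (σ → R) →ₗ[R] MvPolynomial σ R :=
  Fintype.linearCombination R X

theorem linearForm_apply (a : σ → R) : linearForm a = ∑ i, C (a i) * X i := by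
  simp only [linearForm, Fintype.linearCombination_apply, smul_eq_C_mul]

theorem isHomogeneous_linearForm (a : σ → R) : (linearForm a).IsHomogeneous 1 := by
  rw [linearForm_apply]
  exact IsHomogeneous.sum _ _ _ fun _ _ => isHomogeneous_C_mul_X _ _

theorem eval_linearForm (v a : σ → R) : eval v (linearForm a) = a ⬝ᵥ v := by
  simp [linearForm_apply, dotProduct]

theorem aeval_linearForm {S : Type*} [CommSemiring S] [Algebra R S] (f : ι → S) (a : ι → R) :
    aeval f (linearForm a) = ∑ i, a i • f i := by
  simp [linearForm_apply, Algebra.smul_def]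

theorem linearForm_single [DecidableEq σ] (i : σ) :
    linearForm (Pi.single i 1) = (X i : MvPolynomial σ R) := by
  simp [linearForm, Fintype.linearCombination_apply_single]

theorem linearForm_mem_idealOfVars (a : σ → R) : linearForm a ∈ idealOfVars σ R := by
  rw [linearForm_apply]
  exact Ideal.sum_mem _ fun i _ => Ideal.mul_mem_left _ _ (Ideal.subset_span ⟨i, rfl⟩)

end LinearForms

section Homogeneous

variable {R σ : Type*}

theorem homogeneousComponent_add_mul [CommSemiring R] {p b : MvPolynomial σ R} {d : ℕ}
    (hp : p.IsHomogeneous d) (D : ℕ) :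
    homogeneousComponent (d + D) (p * b) = p * homogeneousComponent D b := by
  let _ : GradedAlgebra (homogeneousSubmodule σ R) := MvPolynomial.gradedAlgebra
  have h := DirectSum.coe_decompose_mul_add_of_left_mem (homogeneousSubmodule σ R) (j := D)
    (b := b) hp
  rw [← decomposition.decompose'_apply, ← decomposition.decompose'_apply]
  exact h

theorem eq_sum_monomial_coeff [CommSemiring R] {T : Finset (σ →₀ ℕ)} {D : ℕ}
    (hT : ∀ μ, μ ∈ T ↔ μ.degree = D) {p : MvPolynomial σ R} (hp : p.IsHomogeneous D) :
    p = ∑ μ ∈ T, monomial μ (coeff μ p) := by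
  conv_lhs => rw [p.as_sum]
  refine Finset.sum_subset (fun μ hμ => (hT μ).2 ?_) fun μ _ hμ => ?_
  · by_contra h
    exact mem_support_iff.1 hμ (hp.coeff_eq_zero h)
  · rw [notMem_support_iff.1 hμ, monomial_zero]

theorem isHomogeneous_det [CommRing R] {T : Type*} [Fintype T] [DecidableEq T]
    {L : Matrix T T (MvPolynomial σ R)} (hL : ∀ i j, (L i j).IsHomogeneous 1) :
    L.det.IsHomogeneous (Fintype.card T) := by
  rw [Matrix.det_apply']
  refine IsHomogeneous.sum _ _ _ fun s _ => ?_
  have hprod : (∏ i, L (s i) i).IsHomogeneous (Fintype.card T) := by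
    simpa using IsHomogeneous.prod Finset.univ (fun i => L (s i) i) (fun _ => 1) fun i _ => hL _ _
  simpa using hprod.C_mul ((Equiv.Perm.sign s : ℤ) : R)

end Homogeneous

section SyzygyRowIdeal

open Matrix

/-- The generalized row at `q` of the matrix of all syzygies of `f`: the ideal of the elements
`∑ i, q i * B i`, where `B` runs over the syzygies of `f`. -/
def syzygyRowIdeal {ι S : Type*} [Fintype ι] [CommRing S] (f q : ι → S) : Ideal S :=
  (LinearMap.ker (dotProductBilin S S f)).map (dotProductBilin S S q)

theorem map_syzygyRowIdeal_le {ι S T : Type*} [Fintype ι] [CommRing S] [CommRing T] (φ : S →+* T)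
    (f q : ι → S) : (syzygyRowIdeal f q).map φ ≤ syzygyRowIdeal (φ ∘ f) (φ ∘ q) := by
  rw [Ideal.map_le_iff_le_comap]
  rintro _ ⟨B, hB, rfl⟩
  refine ⟨φ ∘ B, ?_, (RingHom.map_dotProduct φ q B).symm⟩
  exact (RingHom.map_dotProduct φ f B).symm.trans ((congrArg φ hB).trans (map_zero φ))

theorem exists_isHomogeneous_of_mem_sup {R σ ι : Type*} [CommRing R] [Fintype ι]
    {f : ι → MvPolynomial σ R} {d D : ℕ} (hf : ∀ i, (f i).IsHomogeneous d) {q : ι → R}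
    {p x : MvPolynomial σ R} (hp : p.IsHomogeneous D) (hx : x.IsHomogeneous D)
    (h : p ∈ syzygyRowIdeal f (C ∘ q) ⊔ Ideal.span {x}) :
    ∃ (B : ι → MvPolynomial σ R) (c : R), (∀ i, (B i).IsHomogeneous D) ∧ f ⬝ᵥ B = 0 ∧
      p = (C ∘ q) ⬝ᵥ B + C c * x := by
  obtain ⟨_, ⟨B, hB, rfl⟩, _, hb, rfl⟩ := Submodule.mem_sup.1 h
  obtain ⟨b, rfl⟩ := Ideal.mem_span_singleton'.1 hb
  refine ⟨fun i => homogeneousComponent D (B i), coeff 0 b,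
    fun i => homogeneousComponent_isHomogeneous _ _, ?_, ?_⟩
  · have := congrArg (homogeneousComponent (d + D)) hB
    simpa [dotProduct, homogeneousComponent_add_mul (hf _)] using this
  · have hbx : homogeneousComponent D (b * x) = C (coeff 0 b) * x := by
      rw [mul_comm, mul_comm (C _), ← homogeneousComponent_zero]
      exact homogeneousComponent_add_mul hx 0
    rw [← homogeneousComponent_eq_self hp, map_add, hbx]
    simp [dotProduct, homogeneousComponent_C_mul]

end SyzygyRowIdeal

section LeftInverse

open Matrix

variable {k σ ι : Type*} [Field k]

/-- The forms `g` of degree `e` define a rational map which is a left inverse of the rational map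
with coordinates `f`: the composite `g ∘ f` is defined and is the identity of projective space. -/
structure IsRationalLeftInverse (f : ι → MvPolynomial σ k) (g : σ → MvPolynomial ι k)
    (e : ℕ) : Prop where
  isHomogeneous : ∀ i, (g i).IsHomogeneous e
  exists_ne_zero : ∃ i, aeval f (g i) ≠ 0
  mul_X_eq : ∀ i j, aeval f (g i) * X j = aeval f (g j) * X i

theorem det_mul_eq_mul_cramer {S T ι : Type*} [CommRing S] [CommRing T] [Fintype ι]
    [DecidableEq ι] (φ : S →+* T) {L : Matrix ι ι S} {b : ι → S} {m : ι → T} {x : T}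
    (h : L.map φ *ᵥ m = x • (φ ∘ b)) (μ : ι) : φ L.det * m μ = x * φ (L.cramer b μ) := by
  have hadj : (L.map φ).adjugate *ᵥ (L.map φ *ᵥ m) = φ L.det • m := by
    rw [mulVec_mulVec, adjugate_mul, smul_mulVec, one_mulVec, RingHom.map_det,
      RingHom.mapMatrix_apply]
  have hμ := congrFun hadj μ
  rw [h, mulVec_smul, ← cramer_eq_adjugate_mulVec, ← map_cramer] at hμ
  exact hμ.symm

variable [Fintype ι]

-- The remainder `c * X a ^ D` is absorbed by `b`, a linear form with value `c` at `q`.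
theorem exists_linearForm_of_mem_sup {T : Finset (σ →₀ ℕ)} {D : ℕ}
    (hT : ∀ μ, μ ∈ T ↔ μ.degree = D) {f : ι → MvPolynomial σ k} {d : ℕ}
    (hf : ∀ i, (f i).IsHomogeneous d) {q : ι → k} (hq : q ≠ 0) (a : σ) {p : MvPolynomial σ k}
    (hp : p.IsHomogeneous D) (h : p ∈ syzygyRowIdeal f (C ∘ q) ⊔ Ideal.span {X a ^ D}) :
    ∃ (L : (σ →₀ ℕ) → ι → k) (b : ι → k), (∀ μ, L μ ⬝ᵥ q = coeff μ p) ∧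
      ∑ μ ∈ T, aeval f (linearForm (L μ)) * monomial μ 1 =
        X a ^ D * aeval f (linearForm b) := by
  classical
  obtain ⟨B, c, hB, hfB, hqB⟩ := exists_isHomogeneous_of_mem_sup hf hp (isHomogeneous_X_pow a D) h
  obtain ⟨i₀, hi₀⟩ := Function.ne_iff.1 hq
  let b : ι → k := Pi.single i₀ (c / q i₀)
  have hbq : b ⬝ᵥ q = c := by simp [b, div_mul_cancel₀ c hi₀]
  let aD : σ →₀ ℕ := Finsupp.single a D
  have haD : aD ∈ T := (hT _).2 (Finsupp.degree_single a D)
  refine ⟨fun μ => (fun i => coeff μ (B i)) + if μ = aD then b else 0, b, fun μ => ?_, ?_⟩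
  · rw [add_dotProduct, hqB, coeff_add, coeff_C_mul, coeff_X_pow]
    congr 1
    · rw [dotProduct_comm]
      simp [dotProduct, coeff_sum, coeff_C_mul]
    · simp only [eq_comm (a := μ)]
      split_ifs <;> simp [*]
  · have hB₀ : ∑ μ ∈ T, aeval f (linearForm fun i => coeff μ (B i)) * monomial μ 1 = 0 := by
      simp only [aeval_linearForm, Finset.sum_mul, smul_mul_assoc]
      rw [Finset.sum_comm, ← hfB]
      refine Finset.sum_congr rfl fun i _ => ?_
      conv_rhs => rw [eq_sum_monomial_coeff hT (hB i), Finset.mul_sum]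
      refine Finset.sum_congr rfl fun μ _ => ?_
      rw [← mul_smul_comm, smul_monomial, smul_eq_mul, mul_one]
    simp only [map_add, add_mul, Finset.sum_add_distrib, hB₀, zero_add, apply_ite linearForm,
      apply_ite (aeval f), map_zero, ite_mul, zero_mul]
    rw [Finset.sum_ite_eq' _ aD, if_pos haD, mul_comm, X_pow_eq_monomial]

theorem exists_matrix_mulVec_monomial_eq [DecidableEq σ] {T : Finset (σ →₀ ℕ)} {D : ℕ}
    (hT : ∀ μ, μ ∈ T ↔ μ.degree = D) {f : ι → MvPolynomial σ k} {d : ℕ}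
    (hf : ∀ i, (f i).IsHomogeneous d) {q : ι → k} (hq : q ≠ 0) {a : σ}
    (hrow : idealOfVars σ k ^ D ≤ syzygyRowIdeal f (C ∘ q) ⊔ Ideal.span {X a ^ D}) :
    ∃ (L : Matrix T T (MvPolynomial ι k)) (b : T → MvPolynomial ι k),
      (∀ μ ν, (L μ ν).IsHomogeneous 1) ∧ (∀ μ, (b μ).IsHomogeneous 1) ∧ L.map (eval q) = 1 ∧
      L.map (aeval f : _ →ₐ[k] MvPolynomial σ k).toRingHom *ᵥ
        (fun ν => monomial (ν : σ →₀ ℕ) (1 : k)) =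
        (X a ^ D : MvPolynomial σ k) • ((aeval f).toRingHom ∘ b) := by
  choose ℓ b hℓq hℓf using fun μ : T =>
    have hμ := (hT μ).1 μ.2
    exists_linearForm_of_mem_sup hT hf hq a (isHomogeneous_monomial 1 hμ)
      (hrow ((monomial_mem_pow_idealOfVars_iff _ _ one_ne_zero).2 hμ.ge))
  refine ⟨of fun μ ν => linearForm (ℓ μ ν), fun μ => linearForm (b μ),
    fun _ _ => isHomogeneous_linearForm _, fun _ => isHomogeneous_linearForm _, ?_, ?_⟩
  · ext μ ν
    rw [map_apply, of_apply, eval_linearForm, hℓq, coeff_monomial, Matrix.one_apply]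
    simp only [Subtype.ext_iff]
  · ext1 μ
    exact (Finset.sum_coe_sort _ fun ν => aeval f (linearForm (ℓ μ ν)) * monomial ν (1 : k)).trans
      (hℓf μ)

theorem exists_isRationalLeftInverse [Finite σ] {f : ι → MvPolynomial σ k} {d : ℕ}
    (hf : ∀ i, (f i).IsHomogeneous d) {q : ι → k} (hq : q ≠ 0)
    (hfq : ∀ e (h : MvPolynomial ι k), h.IsHomogeneous e → aeval f h = 0 → eval q h = 0)
    {a : σ} {N : ℕ} (hrow : idealOfVars σ k ^ (N + 1) ≤
      syzygyRowIdeal f (C ∘ q) ⊔ Ideal.span {X a ^ (N + 1)}) :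
    ∃ g e, IsRationalLeftInverse f g e := by
  classical
  have := Fintype.ofFinite σ
  let T := Finset.finsuppAntidiag (Finset.univ : Finset σ) (N + 1)
  have hT : ∀ μ, μ ∈ T ↔ μ.degree = N + 1 := fun μ => by
    simp [T, Finset.mem_finsuppAntidiag, Finsupp.degree_eq_sum]
  obtain ⟨L, b, hL, hb, hLq, hLf⟩ := exists_matrix_mulVec_monomial_eq hT hf hq hrow
  have hdet : aeval f L.det ≠ 0 := fun h => by
    have := hfq _ _ (isHomogeneous_det hL) h
    rw [RingHom.map_det, RingHom.mapMatrix_apply, hLq, det_one] at this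
    exact one_ne_zero this
  let μ : σ → T := fun i => ⟨Finsupp.single a N + Finsupp.single i 1, (hT _).2 (by simp)⟩
  have hcramer : ∀ i, aeval f L.det * X i = X a * aeval f (L.cramer b (μ i)) := fun i => by
    refine mul_left_cancel₀ (pow_ne_zero N (X_ne_zero a)) ?_
    have hμ : monomial (μ i : σ →₀ ℕ) (1 : k) = X a ^ N * X i := by
      rw [X_pow_eq_monomial, X, monomial_mul, one_mul]
    have hdetμ : aeval f L.det * monomial (μ i : σ →₀ ℕ) 1 =
        X a ^ (N + 1) * aeval f (L.cramer b (μ i)) := det_mul_eq_mul_cramer _ hLf (μ i)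
    rw [hμ] at hdetμ
    rw [mul_left_comm, hdetμ, pow_succ, mul_assoc]
  refine ⟨fun i => L.cramer b (μ i), Fintype.card T, fun i => ?_, ⟨a, fun h => ?_⟩, fun i j => ?_⟩
  · rw [cramer_apply]
    refine isHomogeneous_det fun ν ν' => ?_
    rw [updateCol_apply]
    split_ifs
    exacts [hb _, hL _ _]
  · have := hcramer a
    rw [h, mul_zero] at this
    exact mul_ne_zero hdet (X_ne_zero a) this
  · refine mul_left_cancel₀ (X_ne_zero (R := k) a) ?_
    rw [← mul_assoc, ← mul_assoc, ← hcramer, ← hcramer]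
    ring

end LeftInverse

section Cremona

variable {k σ ι : Type*} [Field k] {f : ι → MvPolynomial σ k} {g : σ → MvPolynomial ι k} {d e : ℕ}

theorem IsRationalLeftInverse.aeval_aeval_mul_X_pow (hg : IsRationalLeftInverse f g e)
    (hf : ∀ i, (f i).IsHomogeneous d) (i : ι) (j : σ) :
    aeval f (aeval g (f i)) * X j ^ d = aeval f (g j) ^ d * f i := by
  calc aeval f (aeval g (f i)) * X j ^ d
      = aeval (fun l => X j * aeval f (g l)) (f i) := by
        rw [comp_aeval_apply, mul_comm, aeval_mul_of_isHomogeneous (hf i)]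
    _ = aeval (fun l => aeval f (g j) * X l) (f i) := by
        simp only [mul_comm (X j), hg.mul_X_eq]
    _ = aeval f (g j) ^ d * f i := by
        rw [aeval_mul_of_isHomogeneous (hf i), aeval_X_left_apply]

theorem IsRationalLeftInverse.aeval_aeval_ne_zero (hg : IsRationalLeftInverse f g e)
    (hf : ∀ i, (f i).IsHomogeneous d) {i : ι} (hi : f i ≠ 0) : aeval f (aeval g (f i)) ≠ 0 := by
  obtain ⟨a, ha⟩ := hg.exists_ne_zero
  intro h
  have := hg.aeval_aeval_mul_X_pow hf i a
  rw [h, zero_mul] at this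
  exact mul_ne_zero (pow_ne_zero _ ha) hi this.symm

theorem IsRationalLeftInverse.aeval_mul_X_sub_mul_X (hg : IsRationalLeftInverse f g e)
    (hf : ∀ i, (f i).IsHomogeneous d) (i j : ι) :
    aeval f (aeval g (f i) * X j - aeval g (f j) * X i) = 0 := by
  obtain ⟨a, -⟩ := hg.exists_ne_zero
  refine mul_right_cancel₀ (pow_ne_zero d (X_ne_zero a)) ?_
  simp only [map_sub, map_mul, aeval_X, zero_mul]
  linear_combination f j * hg.aeval_aeval_mul_X_pow hf i a - f i * hg.aeval_aeval_mul_X_pow hf j a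

theorem IsRationalLeftInverse.algebraicIndependent [Finite σ] {f g : σ → MvPolynomial σ k}
    (hg : IsRationalLeftInverse f g e) (hf : ∀ i, (f i).IsHomogeneous d) (hd : d ≠ 0)
    (hf₀ : f ≠ 0) : AlgebraicIndependent k f := by
  obtain ⟨i, hi⟩ := Function.ne_iff.1 hf₀
  let R := Algebra.adjoin k (Set.range f)
  have hmem : ∀ p : MvPolynomial σ k, aeval f p ∈ R := fun p => by
    simp only [R, Algebra.adjoin_range_eq_range_aeval]
    exact ⟨p, rfl⟩
  have hR : ∀ p ∈ R, IsAlgebraic R p := fun p hp => isAlgebraic_algebraMap (⟨p, hp⟩ : R)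
  have hX : ∀ j, IsAlgebraic R (X j : MvPolynomial σ k) := fun j => by
    have hmul : IsAlgebraic R (aeval f (aeval g (f i)) * X j ^ d) := by
      rw [hg.aeval_aeval_mul_X_pow hf]
      exact hR _ (R.mul_mem (R.pow_mem (hmem _) _) (Algebra.subset_adjoin ⟨i, rfl⟩))
    exact (IsAlgebraic.of_mul (mem_nonZeroDivisors_of_ne_zero (hg.aeval_aeval_ne_zero hf hi))
      (hR _ (hmem _)) hmul).of_pow hd.bot_lt
  have halg : Algebra.IsAlgebraic R (MvPolynomial σ k) := by
    refine ⟨fun p => ?_⟩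
    induction p using MvPolynomial.induction_on with
    | C c => exact hR _ (R.algebraMap_mem c)
    | add p q hp hq => exact hp.add hq
    | mul_X p j hp => exact hp.mul (hX j)
  refine (Algebra.IsAlgebraic.isTranscendenceBasis_of_lift_le_trdeg_of_finite k f ?_).1
  rw [MvPolynomial.trdeg_of_isDomain]
  simp

theorem IsRationalLeftInverse.subsingleton_of_isHomogeneous_zero
    (hg : IsRationalLeftInverse f g e) (hf : ∀ i, (f i).IsHomogeneous 0) : Subsingleton σ := by
  obtain ⟨a, ha⟩ := hg.exists_ne_zero
  have hconst : ∀ i, aeval f (g i) = C (coeff 0 (aeval f (g i))) := fun i => by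
    rw [← totalDegree_eq_zero_iff_eq_C, totalDegree_zero_iff_isHomogeneous]
    simpa using (hg.isHomogeneous i).aeval f hf
  refine subsingleton_of_forall_eq a fun j => ?_
  by_contra hja
  have hcoeff := congrArg (coeff (Finsupp.single j 1)) (hg.mul_X_eq a j)
  classical
  rw [hconst a, hconst j, coeff_C_mul, coeff_C_mul, coeff_X_same, coeff_X,
    if_neg (by simpa [Finsupp.single_left_inj] using Ne.symm hja), mul_one, mul_zero] at hcoeff
  exact ha (by rw [hconst a, hcoeff, C_0])

theorem IsRationalLeftInverse.isBirationalOntoImage {n r : ℕ}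
    {f : Fin (r + 1) → MvPolynomial (Fin (n + 1)) k}
    {g : Fin (n + 1) → MvPolynomial (Fin (r + 1)) k} (hg : IsRationalLeftInverse f g e)
    (hf : ∀ i, (f i).IsHomogeneous d) (hf₀ : f ≠ 0) : IsBirationalOntoImage f :=
  have ⟨i, hi⟩ := Function.ne_iff.1 hf₀
  ⟨e, g, hg.isHomogeneous, hg.exists_ne_zero, hg.mul_X_eq, ⟨i, hg.aeval_aeval_ne_zero hf hi⟩,
    hg.aeval_mul_X_sub_mul_X hf⟩

theorem IsRationalLeftInverse.isCremona {r : ℕ} {f g : Fin (r + 1) → MvPolynomial (Fin (r + 1)) k}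
    (hg : IsRationalLeftInverse f g e) (hf : ∀ i, (f i).IsHomogeneous d) (hf₀ : f ≠ 0) :
    IsCremona f := by
  obtain ⟨i, hi⟩ := Function.ne_iff.1 hf₀
  refine ⟨e, g, hg.isHomogeneous, hg.exists_ne_zero, hg.mul_X_eq,
    ⟨i, fun h => hg.aeval_aeval_ne_zero hf hi (by rw [h, map_zero])⟩, fun i j => ?_⟩
  rcases eq_or_ne d 0 with rfl | hd
  · have := hg.subsingleton_of_isHomogeneous_zero hf
    rw [Subsingleton.elim i j]
  · exact sub_eq_zero.1 ((hg.algebraicIndependent hf hd hf₀).eq_zero_of_aeval_eq_zero _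
      (hg.aeval_mul_X_sub_mul_X hf i j))

end Cremona

section LinearSubst

open Matrix

variable {R σ τ : Type*} [CommSemiring R] [Fintype τ]

/-- The pullback of polynomial functions along the linear map `w ↦ M *ᵥ w`. -/
def linearSubst (M : Matrix σ τ R) : MvPolynomial σ R →ₐ[R] MvPolynomial τ R :=
  aeval fun a => linearForm (M a)

theorem linearSubst_X (M : Matrix σ τ R) (a : σ) : linearSubst M (X a) = linearForm (M a) :=
  aeval_X _ a

theorem eval_linearSubst (M : Matrix σ τ R) (w : τ → R) (p : MvPolynomial σ R) :
    eval w (linearSubst M p) = eval (M *ᵥ w) p := by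
  have : (aeval w).comp (linearSubst M) = (aeval (M *ᵥ w) : _ →ₐ[R] R) := by
    ext a
    rw [AlgHom.comp_apply, linearSubst_X, aeval_X]
    exact eval_linearForm w (M a)
  exact DFunLike.congr_fun this p

theorem linearSubst_linearForm [Fintype σ] (M : Matrix σ τ R) (a : σ → R) :
    linearSubst M (linearForm a) = linearForm (a ᵥ* M) := by
  rw [linearSubst, aeval_linearForm, vecMul_eq_sum, map_sum]
  simp only [map_smul]

theorem isHomogeneous_linearSubst (M : Matrix σ τ R) {p : MvPolynomial σ R} {d : ℕ}
    (hp : p.IsHomogeneous d) : (linearSubst M p).IsHomogeneous d := by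
  rw [← one_mul d]
  exact hp.aeval _ fun a => isHomogeneous_linearForm (M a)

theorem restrictTo_eq_linearSubst_comp {k : Type*} [Field k] {n r s : ℕ}
    (f : Fin (r + 1) → MvPolynomial (Fin (n + 1)) k) (M : Matrix (Fin (n + 1)) (Fin (s + 1)) k) :
    restrictTo f M = linearSubst M ∘ f := by
  simp only [linearSubst, linearForm_apply]
  rfl

end LinearSubst

section LinearIdeal

open Matrix

variable {k : Type*} [Field k] {n s : ℕ} {V : Submodule k (Fin (n + 1) → k)}

theorem linearForm_mem_linearIdeal {a : Fin (n + 1) → k} (ha : ∀ v ∈ V, a ⬝ᵥ v = 0) :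
    linearForm a ∈ linearIdeal V :=
  Ideal.subset_span ⟨a, ha, linearForm_apply a⟩

theorem linearIdeal_le_iff {J : Ideal (MvPolynomial (Fin (n + 1)) k)} :
    linearIdeal V ≤ J ↔ ∀ a : Fin (n + 1) → k, (∀ v ∈ V, a ⬝ᵥ v = 0) → linearForm a ∈ J := by
  refine ⟨fun h a ha => h (linearForm_mem_linearIdeal ha), fun h => Ideal.span_le.2 ?_⟩
  rintro _ ⟨a, ha, rfl⟩
  exact linearForm_apply a ▸ h a ha

theorem linearIdeal_le_idealOfVars : linearIdeal V ≤ idealOfVars (Fin (n + 1)) k :=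
  linearIdeal_le_iff.2 fun a _ => linearForm_mem_idealOfVars a

theorem linearIdeal_bot : linearIdeal (⊥ : Submodule k (Fin (n + 1) → k)) = idealOfVars _ k := by
  refine le_antisymm linearIdeal_le_idealOfVars (Ideal.span_le.2 ?_)
  rintro _ ⟨i, rfl⟩
  rw [← linearForm_single]
  exact linearForm_mem_linearIdeal fun v hv => by rw [(Submodule.mem_bot k).1 hv, dotProduct_zero]

theorem eval_eq_zero_of_mem_linearIdeal {p : MvPolynomial (Fin (n + 1)) k} (hp : p ∈ linearIdeal V)
    {v : Fin (n + 1) → k} (hv : v ∈ V) : eval v p = 0 := by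
  have : linearIdeal V ≤ RingHom.ker (eval v) :=
    linearIdeal_le_iff.2 fun a ha => (eval_linearForm v a).trans (ha v hv)
  exact this hp

theorem exists_vecMul_eq (M : Matrix (Fin (n + 1)) (Fin (s + 1)) k) {a : Fin (s + 1) → k}
    (ha : ∀ w ∈ V.comap M.mulVecLin, a ⬝ᵥ w = 0) :
    ∃ b : Fin (n + 1) → k, (∀ v ∈ V, b ⬝ᵥ v = 0) ∧ b ᵥ* M = a := by
  have hker : LinearMap.ker (V.mkQ ∘ₗ M.mulVecLin) = V.comap M.mulVecLin := by
    rw [LinearMap.ker_comp, Submodule.ker_mkQ]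
  have hrange : dotProductEquiv k _ a ∈ LinearMap.range (V.mkQ ∘ₗ M.mulVecLin).dualMap := by
    rw [LinearMap.range_dualMap_eq_dualAnnihilator_ker, hker, Submodule.mem_dualAnnihilator]
    exact ha
  obtain ⟨φ, hφ⟩ := hrange
  obtain ⟨b, hb⟩ := (dotProductEquiv k _).surjective (φ ∘ₗ V.mkQ)
  have hbφ : ∀ v, b ⬝ᵥ v = φ (V.mkQ v) := LinearMap.congr_fun hb
  refine ⟨b, fun v hv => ?_, ?_⟩
  · rw [hbφ, Submodule.mkQ_apply, (Submodule.Quotient.mk_eq_zero V).2 hv, map_zero]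
  · refine (dotProductEquiv k _).injective (LinearMap.ext fun w => ?_)
    rw [← hφ]
    exact (dotProduct_mulVec b M w).symm.trans (hbφ _)

theorem linearIdeal_comap_mulVecLin (V : Submodule k (Fin (n + 1) → k))
    (M : Matrix (Fin (n + 1)) (Fin (s + 1)) k) :
    linearIdeal (V.comap M.mulVecLin) = (linearIdeal V).map (linearSubst M) := by
  apply le_antisymm
  · refine linearIdeal_le_iff.2 fun a ha => ?_
    obtain ⟨b, hb, rfl⟩ := exists_vecMul_eq M ha
    rw [← linearSubst_linearForm]
    exact Ideal.mem_map_of_mem _ (linearForm_mem_linearIdeal hb)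
  · refine Ideal.map_le_iff_le_comap.2 (linearIdeal_le_iff.2 fun b hb => ?_)
    rw [Ideal.mem_comap, linearSubst_linearForm]
    exact linearForm_mem_linearIdeal fun w hw => (dotProduct_mulVec b M w).symm.trans (hb _ hw)

theorem exists_matrix_mulVec_mem_and_mulVec_eq (V : Submodule k (Fin (n + 1) → k)) :
    ∃ E : Matrix (Fin (n + 1)) (Fin (n + 1)) k, (∀ w, E *ᵥ w ∈ V) ∧ ∀ v ∈ V, E *ᵥ v = v := by
  obtain ⟨π, hπ⟩ := V.subtype.exists_leftInverse_of_injective V.ker_subtype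
  have hE : ∀ w, LinearMap.toMatrix' (V.subtype ∘ₗ π) *ᵥ w = π w := fun w => by
    rw [← toLin'_apply, toLin'_toMatrix']
    rfl
  exact ⟨_, fun w => hE w ▸ (π w).2,
    fun v hv => (hE v).trans (congrArg Subtype.val (LinearMap.congr_fun hπ ⟨v, hv⟩))⟩

theorem linearIdeal_eq_ker_linearSubst {E : Matrix (Fin (n + 1)) (Fin (n + 1)) k}
    (hE : ∀ w, E *ᵥ w ∈ V) (hEV : ∀ v ∈ V, E *ᵥ v = v) :
    linearIdeal V = RingHom.ker (linearSubst E) := by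
  refine le_antisymm (linearIdeal_le_iff.2 fun a ha => ?_) fun p hp => ?_
  · have haE : a ᵥ* E = 0 := (dotProductEquiv k _).injective (LinearMap.ext fun w => by
      rw [map_zero]
      exact (dotProduct_mulVec a E w).symm.trans (ha _ (hE w)))
    rw [RingHom.mem_ker, linearSubst_linearForm, haE, map_zero]
  · have hmk : (Ideal.Quotient.mkₐ k (linearIdeal V)).comp (linearSubst E) =
        Ideal.Quotient.mkₐ k (linearIdeal V) := by
      ext a
      refine Ideal.Quotient.eq.2 (?_ : linearSubst E (X a) - X a ∈ linearIdeal V)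
      rw [linearSubst_X, ← linearForm_single, ← map_sub]
      refine linearForm_mem_linearIdeal fun v hv => ?_
      rw [sub_dotProduct, single_dotProduct, one_mul, sub_eq_zero]
      exact congrFun (hEV v hv) a
    rw [← Ideal.Quotient.eq_zero_iff_mem, ← Ideal.Quotient.mkₐ_eq_mk k, ← hmk, AlgHom.comp_apply,
      RingHom.mem_ker.1 hp, map_zero]

instance isPrime_linearIdeal (V : Submodule k (Fin (n + 1) → k)) : (linearIdeal V).IsPrime := by
  obtain ⟨E, hE, hEV⟩ := exists_matrix_mulVec_mem_and_mulVec_eq V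
  exact linearIdeal_eq_ker_linearSubst hE hEV ▸ RingHom.ker_isPrime _

theorem exists_eval_ne_zero_of_notMem_linearIdeal [Infinite k] {p : MvPolynomial (Fin (n + 1)) k}
    (hp : p ∉ linearIdeal V) : ∃ v ∈ V, eval v p ≠ 0 := by
  obtain ⟨E, hE, hEV⟩ := exists_matrix_mulVec_mem_and_mulVec_eq V
  by_contra! h
  rw [linearIdeal_eq_ker_linearSubst hE hEV, RingHom.mem_ker] at hp
  exact hp (funext fun w => by rw [eval_linearSubst, h _ (hE w), map_zero])

end LinearIdeal

section Saturation

variable {k : Type*} [Field k] {n : ℕ} {I J : Ideal (MvPolynomial (Fin (n + 1)) k)}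

theorem exists_mul_pow_le_of_le_saturation (h : I ≤ saturation J) :
    ∃ N, I * idealOfVars (Fin (n + 1)) k ^ N ≤ J := by
  let colon : ℕ →o Ideal (MvPolynomial (Fin (n + 1)) k) :=
    ⟨fun N => J.colon ((idealOfVars (Fin (n + 1)) k ^ N : Ideal _) : Set _),
      fun _ _ h => Submodule.colon_mono le_rfl (Ideal.pow_le_pow_right h)⟩
  have hcolon : saturation J = colon _ := WellFoundedGT.iSup_eq_monotonicSequenceLimit colon
  exact ⟨_, Ideal.mul_le.2 fun a ha b hb => Submodule.mem_colon.1 (hcolon ▸ h ha) b hb⟩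

theorem linearIdeal_le_of_saturation_eq {V : Submodule k (Fin (n + 1) → k)}
    (hJ : saturation J = linearIdeal V) {P : Ideal (MvPolynomial (Fin (n + 1)) k)} [P.IsPrime]
    (hP : J ≤ P) : linearIdeal V ≤ P := by
  obtain ⟨N, hN⟩ := exists_mul_pow_le_of_le_saturation hJ.ge
  refine (‹P.IsPrime›.mul_le.1 (hN.trans hP)).elim id fun h => ?_
  exact linearIdeal_le_idealOfVars.trans (‹P.IsPrime›.le_of_pow_le h)

theorem le_saturation (J : Ideal (MvPolynomial (Fin (n + 1)) k)) : J ≤ saturation J :=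
  fun _ ha => mem_saturation.2 ⟨0, fun _ _ => J.mul_mem_right _ ha⟩

end Saturation

section BirationalityCriterion

open Matrix

variable {k : Type*} [Field k] {n r d N : ℕ}

theorem sup_pow_succ_le {S : Type*} [CommSemiring S] (I J : Ideal S) (N : ℕ) :
    (I ⊔ J) ^ (N + 1) ≤ I * (I ⊔ J) ^ N ⊔ J ^ (N + 1) := by
  induction N with
  | zero => simp
  | succ N ih =>
    calc (I ⊔ J) ^ (N + 2) = I * (I ⊔ J) ^ (N + 1) ⊔ J * (I ⊔ J) ^ (N + 1) := by
          rw [pow_succ', Ideal.sup_mul]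
      _ ≤ I * (I ⊔ J) ^ (N + 1) ⊔ (I * (J * (I ⊔ J) ^ N) ⊔ J ^ (N + 2)) := by
          refine sup_le_sup_left ((Ideal.mul_mono_right ih).trans_eq ?_) _
          rw [Ideal.mul_sup, mul_left_comm, ← pow_succ']
      _ ≤ I * (I ⊔ J) ^ (N + 1) ⊔ J ^ (N + 2) := by
          rw [← sup_assoc]
          refine sup_le_sup_right (sup_le le_rfl (Ideal.mul_mono_right ?_)) _
          rw [pow_succ']
          exact Ideal.mul_mono_left le_sup_right

theorem idealOfVars_le_linearIdeal_span_singleton_sup {v : Fin (n + 1) → k} {a : Fin (n + 1)}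
    (hva : v a ≠ 0) : idealOfVars (Fin (n + 1)) k ≤ linearIdeal (k ∙ v) ⊔ Ideal.span {X a} := by
  rw [idealOfVars, Ideal.span_le]
  rintro _ ⟨i, rfl⟩
  have hform : (X i : MvPolynomial (Fin (n + 1)) k) =
      linearForm (Pi.single i 1 - (v i / v a) • Pi.single a 1) + C (v i / v a) * X a := by
    rw [map_sub, map_smul, linearForm_single, linearForm_single, smul_eq_C_mul, sub_add_cancel]
  rw [hform]
  refine Submodule.add_mem_sup (linearForm_mem_linearIdeal fun w hw => ?_)
    (Ideal.mul_mem_left _ _ (Ideal.mem_span_singleton_self _))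
  obtain ⟨c, rfl⟩ := Submodule.mem_span_singleton.1 hw
  simp only [sub_dotProduct, smul_dotProduct, single_dotProduct, one_mul, Pi.smul_apply,
    smul_eq_mul]
  field_simp
  ring

theorem exists_isRationalLeftInverse_of_linearIdeal_mul_pow_le
    {f : Fin (r + 1) → MvPolynomial (Fin (n + 1)) k} (hf : ∀ i, (f i).IsHomogeneous d)
    {v : Fin (n + 1) → k} (hv : v ≠ 0) {q : Fin (r + 1) → k} (hq : q ≠ 0)
    (hfq : MapsGenericPointTo f (linearIdeal (k ∙ v)) (C ∘ q))
    (hrow : linearIdeal (k ∙ v) * idealOfVars (Fin (n + 1)) k ^ N ≤ syzygyRowIdeal f (C ∘ q)) :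
    ∃ g e, IsRationalLeftInverse f g e := by
  obtain ⟨a, hva⟩ := Function.ne_iff.1 hv
  have hvars : idealOfVars (Fin (n + 1)) k = linearIdeal (k ∙ v) ⊔ Ideal.span {X a} := by
    refine (idealOfVars_le_linearIdeal_span_singleton_sup hva).antisymm (sup_le ?_ ?_)
    · exact linearIdeal_le_idealOfVars
    · exact (Ideal.span_singleton_le_iff_mem _).2 (Ideal.subset_span ⟨a, rfl⟩)
  refine exists_isRationalLeftInverse hf hq (a := a) (N := N)
    (fun e h hh hfh => hfq.eval_eq_zero hh (hfh ▸ zero_mem _)) ?_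
  calc idealOfVars (Fin (n + 1)) k ^ (N + 1)
      ≤ linearIdeal (k ∙ v) * idealOfVars (Fin (n + 1)) k ^ N ⊔ Ideal.span {X a} ^ (N + 1) := by
        conv_lhs => rw [hvars]
        conv_rhs => rw [hvars]
        exact sup_pow_succ_le _ _ N
    _ ≤ syzygyRowIdeal f (C ∘ q) ⊔ Ideal.span {X a ^ (N + 1)} := by
        rw [Ideal.span_singleton_pow]
        exact sup_le_sup_right hrow _

end BirationalityCriterion

section GeneralPosition

open Matrix

variable {k : Type*} [Field k] {n r : ℕ} {V : Submodule k (Fin (n + 1) → k)}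

theorem exists_linearMap_ker_eq {E : Type*} [AddCommGroup E] [Module k E] [FiniteDimensional k E]
    {V : Submodule k E} (hV : Module.finrank k V + r = Module.finrank k E) :
    ∃ φ : E →ₗ[k] (Fin r → k), Function.Surjective φ ∧ LinearMap.ker φ = V := by
  have hr : Module.finrank k (E ⧸ V) = Module.finrank k (Fin r → k) := by
    have := V.finrank_quotient_add_finrank
    rw [Module.finrank_fin_fun]
    omega
  refine ⟨(LinearEquiv.ofFinrankEq _ _ hr).toLinearMap ∘ₗ V.mkQ,
    (LinearEquiv.surjective _).comp V.mkQ_surjective, ?_⟩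
  rw [LinearEquiv.ker_comp, Submodule.ker_mkQ]

theorem exists_linearMap_comap_eq_and_comp_eq_id {E : Type*} [AddCommGroup E] [Module k E]
    [FiniteDimensional k E] {V : Submodule k E}
    (hV : Module.finrank k V + r = Module.finrank k E) {v : E} (hv : v ∈ V) (hv₀ : v ≠ 0) :
    ∃ (ψ : E →ₗ[k] (Fin (r + 1) → k)) (μ : (Fin (r + 1) → k) →ₗ[k] E),
      (k ∙ Pi.single 0 1).comap ψ = V ∧ ψ ∘ₗ μ = LinearMap.id ∧ μ (Pi.single 0 1) = v := by
  obtain ⟨φ, hφ, rfl⟩ := exists_linearMap_ker_eq hV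
  obtain ⟨σ, hσ⟩ := φ.exists_rightInverse_of_surjective (LinearMap.range_eq_top.2 hφ)
  let cons : (k × (Fin r → k)) ≃ₗ[k] (Fin (r + 1) → k) := Fin.consLinearEquiv k fun _ => k
  have hsingle : ∀ c : k, (c • Pi.single 0 1 : Fin (r + 1) → k) = cons (c, 0) := fun c => by
    ext i
    refine Fin.cases ?_ (fun i => ?_) i <;> simp [cons]
  let τ : k × (Fin r → k) →ₗ[k] E := (LinearMap.toSpanSingleton k E v).coprod σ
  have hφτ : ∀ c, φ (τ c) = c.2 := fun c => by
    have hφv : φ v = 0 := hv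
    have hφσ : φ (σ c.2) = c.2 := LinearMap.congr_fun hσ c.2
    simp [τ, hφv, hφσ]
  have hτ : LinearMap.ker τ = ⊥ := by
    refine LinearMap.ker_eq_bot'.2 fun c hc => ?_
    have hc₂ : c.2 = 0 := by rw [← hφτ, hc, map_zero]
    have hc₁ : c.1 • v + σ c.2 = 0 := hc
    rw [hc₂, map_zero, add_zero, smul_eq_zero_iff_left hv₀] at hc₁
    exact Prod.ext hc₁ hc₂
  obtain ⟨ℓ, hℓ⟩ := τ.exists_leftInverse_of_injective hτ
  refine ⟨cons.toLinearMap ∘ₗ (LinearMap.fst k k _ ∘ₗ ℓ).prod φ, τ ∘ₗ cons.symm.toLinearMap,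
    ?_, ?_, ?_⟩
  · ext x
    simp [Submodule.mem_span_singleton, hsingle, eq_comm (a := (0 : Fin r → k))]
  · refine LinearMap.ext fun c => cons.symm.injective ?_
    have hℓc : ℓ (τ (cons.symm c)) = cons.symm c := LinearMap.congr_fun hℓ _
    simp [hℓc, hφτ]
  · rw [← one_smul k (Pi.single 0 1 : Fin (r + 1) → k), hsingle]
    simp [τ]

theorem comap_mulVecLin_span_singleton {ι : Type*} [Fintype ι] [DecidableEq ι] {B : Matrix ι ι k}
    (hB : B.det ≠ 0) (y : ι → k) : (k ∙ y).comap B.mulVecLin = k ∙ B.cramer y := by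
  ext x
  simp only [Submodule.mem_comap, mulVecLin_apply, Submodule.mem_span_singleton]
  constructor
  · rintro ⟨c, hc⟩
    refine ⟨c / B.det, ?_⟩
    rw [cramer_eq_adjugate_mulVec, ← mulVec_smul]
    have : (c / B.det) • y = B *ᵥ (B.det⁻¹ • x) := by
      rw [mulVec_smul, ← hc, smul_smul, div_eq_inv_mul]
    rw [this, mulVec_mulVec, adjugate_mul, smul_mulVec, one_mulVec, smul_inv_smul₀ hB]
  · rintro ⟨c, rfl⟩
    exact ⟨c * B.det, by rw [mulVec_smul, mulVec_cramer, mul_smul]⟩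

theorem exists_polynomial_eval_eq {R σ τ : Type*} [CommRing R] [Fintype σ] [Fintype τ]
    [DecidableEq τ] (p : MvPolynomial σ R) (L : Matrix τ σ R) (y : τ → R) :
    ∃ G : MvPolynomial (σ × τ) R, ∀ M : Matrix σ τ R, eval (fun ab => M ab.1 ab.2) G =
      (L * M).det * eval (M *ᵥ (L * M).cramer y) p := by
  let X' := mvPolynomialX σ τ R
  let L' : Matrix τ σ (MvPolynomial (σ × τ) R) := L.map C
  let B := L' * X'
  refine ⟨B.det * aeval (X' *ᵥ B.cramer (C ∘ y)) p, fun M => ?_⟩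
  let ε := eval fun ab : σ × τ => M ab.1 ab.2
  have hX : X'.map ε = M := mvPolynomialX_map_eval₂ _ M
  have hε : ε ∘ C = id := funext fun c => eval_C c
  have hB : B.map ε = L * M := by
    simp only [B, L', Matrix.map_mul, hX, Matrix.map_map, hε, Matrix.map_id]
  have hw : ε ∘ (X' *ᵥ B.cramer (C ∘ y)) = M *ᵥ (L * M).cramer y := by
    have hy : (L * M).cramer y = ε ∘ B.cramer (C ∘ y) := by
      rw [map_cramer, hB, ← Function.comp_assoc, hε, Function.id_comp]
    rw [hy, ← hX]
    exact funext (RingHom.map_mulVec ε _ _)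
  rw [← hw, ← hB, map_mul]
  congr 1
  · exact RingHom.map_det ε B
  · exact comp_aeval_apply _ (aeval fun ab : σ × τ => M ab.1 ab.2) p

theorem forGeneralLinearSubspace_comap_eq_span_singleton [Infinite k] (hV₀ : V ≠ ⊥)
    (hV : Module.finrank k V + r = n + 1) {p : MvPolynomial (Fin (n + 1)) k}
    (hp : p ∉ linearIdeal V) : ForGeneralLinearSubspace n r fun M =>
      ∃ w ≠ 0, V.comap M.mulVecLin = k ∙ w ∧ eval (M *ᵥ w) p ≠ 0 := by
  obtain ⟨u, hu, hu₀⟩ := V.exists_mem_ne_zero_of_ne_bot hV₀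
  obtain ⟨b, hub⟩ := Function.ne_iff.1 hu₀
  have hb : X b ∉ linearIdeal V := fun h =>
    hub ((eval_X b).symm.trans (eval_eq_zero_of_mem_linearIdeal h hu))
  obtain ⟨v, hv, hvp⟩ := exists_eval_ne_zero_of_notMem_linearIdeal
    ((isPrime_linearIdeal V).mul_notMem hp hb)
  rw [map_mul, eval_X] at hvp
  have hv₀ : v ≠ 0 := fun h => right_ne_zero_of_mul hvp (congrFun h b)
  obtain ⟨ψ, μ, rfl, hψμ, hμ⟩ := exists_linearMap_comap_eq_and_comp_eq_id
    (hV.trans (Module.finrank_fin_fun k).symm) hv hv₀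
  obtain ⟨G, hG⟩ := exists_polynomial_eval_eq p (LinearMap.toMatrix' ψ) (Pi.single 0 1)
  refine ⟨G, fun h => ?_, fun M _ hM => ?_⟩
  · have hGμ := hG (LinearMap.toMatrix' μ)
    rw [h, map_zero, ← LinearMap.toMatrix'_comp, hψμ, LinearMap.toMatrix'_id, det_one, one_mul,
      cramer_one, Module.End.one_apply, ← toLin'_apply, toLin'_toMatrix', hμ] at hGμ
    exact left_ne_zero_of_mul hvp hGμ.symm
  · rw [hG] at hM
    have hdet := left_ne_zero_of_mul hM
    refine ⟨_, fun h => hdet ?_, ?_, right_ne_zero_of_mul hM⟩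
    · have := mulVec_cramer (LinearMap.toMatrix' ψ * M) (Pi.single 0 1)
      rw [h, mulVec_zero] at this
      simpa using (congrFun this 0).symm
    · rw [← comap_mulVecLin_span_singleton hdet, mulVecLin_mul, Submodule.comap_comp,
        ← toLin'_apply' (LinearMap.toMatrix' ψ), toLin'_toMatrix']

end GeneralPosition

section Restriction

open Matrix

variable {k : Type*} [Field k] {n r s d N : ℕ} {V : Submodule k (Fin (n + 1) → k)}
  {f : Fin (r + 1) → MvPolynomial (Fin (n + 1)) k} {q : Fin (r + 1) → k}

theorem algHom_comp_C_comp {R σ τ ι : Type*} [CommSemiring R]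
    (φ : MvPolynomial σ R →ₐ[R] MvPolynomial τ R) (q : ι → R) : φ ∘ C ∘ q = C ∘ q := by
  ext1 i
  rw [Function.comp_apply, Function.comp_apply, algHom_C, algebraMap_eq, Function.comp_apply]

theorem ker_mulVecLin_eq_bot_of_rank_eq {M : Matrix (Fin (n + 1)) (Fin (s + 1)) k}
    (hM : M.rank = s + 1) : LinearMap.ker M.mulVecLin = ⊥ := by
  have hrank := M.mulVecLin.finrank_range_add_finrank_ker
  rw [Module.finrank_fin_fun, ← Matrix.rank, hM, Nat.add_eq_left] at hrank
  exact Submodule.finrank_eq_zero.1 hrank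

theorem map_linearSubst_idealOfVars {M : Matrix (Fin (n + 1)) (Fin (s + 1)) k}
    (hM : LinearMap.ker M.mulVecLin = ⊥) :
    (idealOfVars (Fin (n + 1)) k).map (linearSubst M) = idealOfVars (Fin (s + 1)) k := by
  rw [← linearIdeal_bot, ← linearIdeal_bot, ← linearIdeal_comap_mulVecLin, Submodule.comap_bot, hM]

theorem linearIdeal_comap_mul_pow_le {M : Matrix (Fin (n + 1)) (Fin (s + 1)) k}
    (hM : LinearMap.ker M.mulVecLin = ⊥)
    (hrow : linearIdeal V * idealOfVars (Fin (n + 1)) k ^ N ≤ syzygyRowIdeal f (C ∘ q)) :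
    linearIdeal (V.comap M.mulVecLin) * idealOfVars (Fin (s + 1)) k ^ N ≤
      syzygyRowIdeal (linearSubst M ∘ f) (C ∘ q) := by
  rw [linearIdeal_comap_mulVecLin, ← map_linearSubst_idealOfVars hM, ← Ideal.map_pow,
    ← Ideal.map_mul, ← algHom_comp_C_comp (linearSubst M) q]
  exact (Ideal.map_mono hrow).trans (map_syzygyRowIdeal_le (linearSubst M).toRingHom f _)

theorem MapsGenericPointTo.linearSubst_comp (hfq : MapsGenericPointTo f (linearIdeal V) (C ∘ q))
    {M : Matrix (Fin (n + 1)) (Fin (s + 1)) k} {w : Fin (s + 1) → k} (hw : M *ᵥ w ∈ V)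
    {i : Fin (r + 1)} (hi : eval (M *ᵥ w) (f i) ≠ 0) :
    MapsGenericPointTo (linearSubst M ∘ f) (linearIdeal (V.comap M.mulVecLin)) (C ∘ q) where
  exists_notMem := ⟨i, fun h => hi <| by
    rw [← eval_linearSubst]
    exact eval_eq_zero_of_mem_linearIdeal h hw⟩
  mul_sub_mul_mem i j := by
    rw [← algHom_comp_C_comp (linearSubst M) q, linearIdeal_comap_mulVecLin]
    have := Ideal.mem_map_of_mem (linearSubst M) (hfq.mul_sub_mul_mem i j)
    rwa [map_sub, map_mul, map_mul] at this

theorem forGeneralLinearSubspace_isCremona [Infinite k] (hf : ∀ i, (f i).IsHomogeneous d)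
    (hV₀ : V ≠ ⊥) (hV : Module.finrank k V + r = n + 1) (hq : q ≠ 0)
    (hfq : MapsGenericPointTo f (linearIdeal V) (C ∘ q))
    (hrow : linearIdeal V * idealOfVars (Fin (n + 1)) k ^ N ≤ syzygyRowIdeal f (C ∘ q)) :
    ForGeneralLinearSubspace n r fun M => IsCremona (restrictTo f M) := by
  obtain ⟨i, hi⟩ := hfq.exists_notMem
  obtain ⟨G, hG, hGM⟩ := forGeneralLinearSubspace_comap_eq_span_singleton hV₀ hV hi
  refine ⟨G, hG, fun M hM hMG => ?_⟩
  obtain ⟨w, hw₀, hVw, hfw⟩ := hGM M hM hMG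
  have hw : w ∈ V.comap M.mulVecLin := hVw ▸ Submodule.mem_span_singleton_self w
  have hfMq := hfq.linearSubst_comp hw hfw
  have hMrow := linearIdeal_comap_mul_pow_le (ker_mulVecLin_eq_bot_of_rank_eq hM) hrow
  rw [hVw] at hfMq hMrow
  have hfM : ∀ i, (linearSubst M (f i)).IsHomogeneous d := fun i =>
    isHomogeneous_linearSubst M (hf i)
  obtain ⟨g, e, hg⟩ := exists_isRationalLeftInverse_of_linearIdeal_mul_pow_le hfM hw₀ hq hfMq hMrow
  rw [restrictTo_eq_linearSubst_comp]
  exact hg.isCremona hfM hfMq.ne_zero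

end Restriction

section GeneralizedRow

open Matrix

variable {k : Type*} [Field k] {n r d m : ℕ} {f : Fin (r + 1) → MvPolynomial (Fin (n + 1)) k}
  {A : Matrix (Fin (r + 1)) (Fin m) (MvPolynomial (Fin (n + 1)) k)} {q : ℙ k (Fin (r + 1) → k)}

theorem vecMul_mem_generalizedRowIdeal (j : Fin m) :
    ((C ∘ q.rep) ᵥ* A) j ∈ generalizedRowIdeal A q :=
  Ideal.subset_span ⟨j, rfl⟩

theorem generalizedRowIdeal_le_syzygyRowIdeal (hfA : f ᵥ* A = 0) :
    generalizedRowIdeal A q ≤ syzygyRowIdeal f (C ∘ q.rep) := by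
  refine Ideal.span_le.2 ?_
  rintro _ ⟨j, rfl⟩
  exact ⟨fun i => A i j, congrFun hfA j, rfl⟩

theorem mapsGenericPointTo_of_saturation_eq (hfA : f ᵥ* A = 0)
    (hf : 2 ≤ (Ideal.span (Set.range f)).height) {P : Ideal (MvPolynomial (Fin (n + 1)) k)}
    [P.IsPrime] (hP : generalizedRowIdeal A q ≤ P)
    (hrank : (A.map (algebraMap (MvPolynomial (Fin (n + 1)) k) P.ResidueField)).rank = r)
    {V : Submodule k (Fin (n + 1) → k)}
    (hV : saturation (generalizedRowIdeal A q) = linearIdeal V) :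
    MapsGenericPointTo f (linearIdeal V) (C ∘ q.rep) := by
  obtain ⟨i₀, hi₀⟩ := Function.ne_iff.1 q.rep_nonzero
  have hq : ∀ J : Ideal (MvPolynomial (Fin (n + 1)) k), J.IsPrime → (C ∘ q.rep) i₀ ∉ J :=
    fun J hJ h => hJ.ne_top (J.eq_top_of_isUnit_mem h ((isUnit_iff_ne_zero.2 hi₀).map C))
  obtain ⟨s, hs⟩ := exists_det_submatrix_notMem A P hrank
    (fun j => hP (vecMul_mem_generalizedRowIdeal j)) (hq P ‹_›)
  exact mapsGenericPointTo_of_det_notMem hfA hf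
    (fun j => hV ▸ le_saturation _ (vecMul_mem_generalizedRowIdeal j)) (hq _ inferInstance)
    fun h => hs (linearIdeal_le_of_saturation_eq hV hP h)

theorem exists_linearIdeal_mul_pow_le_syzygyRowIdeal (hfA : f ᵥ* A = 0)
    {V : Submodule k (Fin (n + 1) → k)}
    (hV : saturation (generalizedRowIdeal A q) = linearIdeal V) :
    ∃ N, linearIdeal V * idealOfVars (Fin (n + 1)) k ^ N ≤ syzygyRowIdeal f (C ∘ q.rep) :=
  have ⟨N, hN⟩ := exists_mul_pow_le_of_le_saturation hV.ge
  ⟨N, hN.trans (generalizedRowIdeal_le_syzygyRowIdeal hfA)⟩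

end GeneralizedRow

end RowIdeals

end

theorem mainTheorem5_general {k : Type*} [Field k] {n r d m : ℕ}
    {f : Fin (r + 1) → MvPolynomial (Fin (n + 1)) k} (hf : ∀ i, (f i).IsHomogeneous d)
    (hcodim : 2 ≤ (Ideal.span (Set.range f)).height)
    {A : Matrix (Fin (r + 1)) (Fin m) (MvPolynomial (Fin (n + 1)) k)}
    (hsyz : ∀ j, ∑ i, f i * A i j = 0) {q : ℙ k (Fin (r + 1) → k)}
    {P : Ideal (MvPolynomial (Fin (n + 1)) k)} [P.IsPrime]
    (hP : RowIdeals.generalizedRowIdeal A q ≤ P)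
    (hrank : (A.map (algebraMap (MvPolynomial (Fin (n + 1)) k) P.ResidueField)).rank = r) :
    (RowIdeals.DefinesReducedRationalPoint (RowIdeals.generalizedRowIdeal A q) →
      RowIdeals.IsBirationalOntoImage f) ∧
    (Infinite k → RowIdeals.DefinesReducedLinearSpace (RowIdeals.generalizedRowIdeal A q) r →
      RowIdeals.ForGeneralLinearSubspace n r
        (fun M => RowIdeals.IsCremona (RowIdeals.restrictTo f M))) := by
  have hfA : Matrix.vecMul f A = 0 := funext hsyz
  constructor
  · rintro ⟨p, hp⟩
    obtain ⟨N, hrow⟩ := RowIdeals.exists_linearIdeal_mul_pow_le_syzygyRowIdeal hfA hp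
    have hfq := RowIdeals.mapsGenericPointTo_of_saturation_eq hfA hcodim hP hrank hp
    have hf₀ := hfq.ne_zero
    rw [p.submodule_eq] at hfq hrow
    obtain ⟨g, e, hg⟩ := RowIdeals.exists_isRationalLeftInverse_of_linearIdeal_mul_pow_le hf
      p.rep_nonzero q.rep_nonzero hfq hrow
    exact hg.isBirationalOntoImage hf hf₀
  · rintro _ ⟨V, hV₀, hVr, hV⟩
    obtain ⟨N, hrow⟩ := RowIdeals.exists_linearIdeal_mul_pow_le_syzygyRowIdeal hfA hV
    exact RowIdeals.forGeneralLinearSubspace_isCremona hf hV₀ hVr q.rep_nonzero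
      (RowIdeals.mapsGenericPointTo_of_saturation_eq hfA hcodim hP hrank hV) hrow

theorem mainTheorem5 {k : Type*} [Field k] [Infinite k] (n r d m : ℕ)
    (f : Fin (r + 1) → MvPolynomial (Fin (n + 1)) k)
    (hf : ∀ i, (f i).IsHomogeneous d)
    (hlin : LinearIndependent k f)
    (hcodim : 2 ≤ (Ideal.span (Set.range f)).height)
    (A : Matrix (Fin (r + 1)) (Fin m) (MvPolynomial (Fin (n + 1)) k))
    (hA : ∀ i j, ∃ e : ℕ, (A i j).IsHomogeneous e)
    (hsyz : ∀ j, ∑ i, f i * A i j = 0)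
    (q : ℙ k (Fin (r + 1) → k))
    (P : Ideal (MvPolynomial (Fin (n + 1)) k)) [P.IsPrime]
    (hP : RowIdeals.generalizedRowIdeal A q ≤ P)
    (hrank : (A.map (algebraMap (MvPolynomial (Fin (n + 1)) k) P.ResidueField)).rank = r) :
    (RowIdeals.DefinesReducedRationalPoint (RowIdeals.generalizedRowIdeal A q) →
      RowIdeals.IsBirationalOntoImage f) ∧
    (RowIdeals.DefinesReducedLinearSpace (RowIdeals.generalizedRowIdeal A q) r →
      RowIdeals.ForGeneralLinearSubspace n r
        (fun M => RowIdeals.IsCremona (RowIdeals.restrictTo f M))) :=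
  (mainTheorem5_general hf hcodim hsyz hP hrank).imp_right fun h => h ‹_›
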